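/- Let $p>3$ be a prime. For integers $n\ge 0$, $a\ge 1$ put $H_n(a)=\sum_{k=1}^{n}\frac{1}{k^a}$ (so $H_0(a)=0$), and let $B_m\in\mathbb{Q}$ be the Bernoulli numbers, defined by $\frac{t}{e^t-1}=\sum_{m=0}^{\infty}B_m\frac{t^m}{m!}$. Then $$ 4\sum_{k=1}^{p-1}\frac{1}{k^4\binom{2k}{k}}-3\sum_{k=1}^{p-1}\frac{H_{k-1}(2)}{k^2\binom{2k}{k}} \equiv \frac{3}{p^3}H_{p-1}(1)-\frac{6}{5}\,p\,B_{p-5} \pmod{p^2}, $$ where for rational numbers $x,y$ the congruence $x\equiv y\pmod{p^2}$ means that $x-y=p^2r$ for some rational number $r$ whose reduced denominator is not divisible by $p$. -/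

import Mathlib

/-- The harmonic sum `H_n(a) = ∑_{k=1}^{n} 1 / k ^ a` of depth one, as a rational number
(`H_0(a) = 0`). -/
def harmonicSum (n a : ℕ) : ℚ :=
  ∑ k ∈ Finset.Icc 1 n, 1 / (k : ℚ) ^ a

/-- Congruence of rational numbers modulo `p ^ n`: the difference `x - y` is `p ^ n` times a
rational number whose reduced denominator is not divisible by `p`. The numbers `x` and `y`
themselves may have denominators divisible by `p`. -/
def RatCongr (p n : ℕ) (x y : ℚ) : Prop :=
  ∃ r : ℚ, ¬ p ∣ r.den ∧ x - y = (p : ℚ) ^ n * r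

/-!
The congruence is the `p`-adic shadow of Leshchiner's series
`4 ∑ 1 / (k ^ 4 C(2k, k)) - 3 ∑ H_{k-1}(2) / (k ^ 2 C(2k, k)) = 2 ∑ (-1) ^ (k - 1) / k ^ 4`.
The series has a finite form (`sum_inv_choose_eq`), obtained from a WZ pair: the sum over `k ≤ n` of
the left side is the sum over `k ≤ n` of the right side plus an explicit remainder. At `n = p - 1`
the factorials in the remainder become the products `Q_k = ∏_{j<k} (1 - p ^ 2 / j ^ 2)`, and
the remainder is `-∑ H_{k-1}(2) / (p (p - k) Q_k)` (`self_mul_sum_inv_choose`). Expanding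
`1 / (p - k)` and `1 / Q_k` in powers of `p` expresses it through multiple harmonic sums
(`sum_inv_sineProduct_mem`).

Write `H(a)` and `H(a, b)` for the harmonic sums up to `p - 1`, the inner exponent `a` first.
The dominant term `H(2, 1)` is needed modulo `p ^ 3`. It comes from the terminating
Gauss sum `∑_{k≤n} (1 / k) ∏_{j<k} (1 - n ^ 2 / j ^ 2) = (-1) ^ (n - 1) / n` at `n = p`
(`doubleHarmonicSum_two_one_mem`), which gives
`H(2, 1) ≡ H(1) / p ^ 2 - H(2) / p + ⋯`. The expansion of `∑ 1 / (p - k)` turns `-H(2) / p` into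
`2 H(1) / p ^ 2 + H(3) + ⋯`, and this is where the coefficient `3` of `H(1) / p ^ 3` arises.
The accompanying `H(3) / p` is the term `-(6 / 5) p B_{p-5}`, since `2 H(3) ≡ -3 p H(4)` modulo
`p ^ 3` (`two_mul_harmonicSum_three_mem`).

What is left has weight five modulo `p`, and its parts are multiples of `B = B_{p-5}` that cancel:
the triple sums reduce to double sums by the reflection `k ↦ p - k`
(`sum_harmonicSum_sq_div_mem`); `H(4, 1) ≡ -B` and `H(2, 3) ≡ -2 B` follow from Faulhaber's
formula (`doubleHarmonicSum_add_faulhaberCoeff_mem`); `2 ∑ (-1) ^ (k - 1) / k ^ 4 ≡ -(15 / 8) H(4)`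
modulo `p ^ 2`, by comparing even, odd, small and large residues
(`sum_alternating_add_harmonicSum_mem`); and `5 H(4) ≡ 4 p B` modulo `p ^ 2`
(`five_mul_harmonicSum_four_mem`) by the same comparison for the exponents `-4` and `p - 5`, in
place of Kummer's congruence. These arguments need `p ≥ 7`; for `p = 5` both sides are evaluated.
-/

open Finset

/-! ### Rational numbers divisible by a power of `p` -/

/-- The additive group `p ^ n ℤ_(p)` of the rational numbers that are `p ^ n` times a `p`-integral
rational number. -/
def padicMultiples (p n : ℕ) [hp : Fact p.Prime] : AddSubgroup ℚ where
  carrier := {x | ∃ r : ℚ, ¬ p ∣ r.den ∧ x = (p : ℚ) ^ n * r}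
  zero_mem' := ⟨0, by simpa using hp.out.one_lt.ne', by simp⟩
  neg_mem' := by
    rintro _ ⟨r, hr, rfl⟩
    exact ⟨-r, by simpa using hr, by ring⟩
  add_mem' := by
    rintro _ _ ⟨r, hr, rfl⟩ ⟨s, hs, rfl⟩
    refine ⟨r + s, fun h => ?_, by ring⟩
    exact (hp.out.dvd_mul.1 (h.trans (Rat.add_den_dvd r s))).elim hr hs

namespace padicMultiples

variable {p : ℕ} [hp : Fact p.Prime] {m n : ℕ} {x y : ℚ}

theorem mul_mem (hx : x ∈ padicMultiples p m) (hy : y ∈ padicMultiples p n) :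
    x * y ∈ padicMultiples p (m + n) := by
  obtain ⟨r, hr, rfl⟩ := hx
  obtain ⟨s, hs, rfl⟩ := hy
  refine ⟨r * s, fun h => ?_, by ring⟩
  exact (hp.out.dvd_mul.1 (h.trans (Rat.mul_den_dvd r s))).elim hr hs

theorem mul_mem_left (hx : x ∈ padicMultiples p 0) (hy : y ∈ padicMultiples p n) :
    x * y ∈ padicMultiples p n := by
  simpa using mul_mem hx hy

theorem mul_mem_right (hx : x ∈ padicMultiples p n) (hy : y ∈ padicMultiples p 0) :
    x * y ∈ padicMultiples p n := by
  simpa using mul_mem hx hy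

theorem natCast_mem (k : ℕ) : (k : ℚ) ∈ padicMultiples p 0 :=
  ⟨k, by simpa using hp.out.one_lt.ne', by simp⟩

theorem ofNat_mem (k : ℕ) [k.AtLeastTwo] : (OfNat.ofNat k : ℚ) ∈ padicMultiples p 0 :=
  natCast_mem k

theorem one_mem : (1 : ℚ) ∈ padicMultiples p 0 := by simpa using natCast_mem (p := p) 1

theorem pow_self_mem (n : ℕ) : (p : ℚ) ^ n ∈ padicMultiples p n :=
  ⟨1, by simpa using hp.out.one_lt.ne', by simp⟩

theorem pow_mul_mem (n : ℕ) (hx : x ∈ padicMultiples p m) :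
    (p : ℚ) ^ n * x ∈ padicMultiples p (n + m) :=
  mul_mem (pow_self_mem n) hx

theorem self_mul_mem (hx : x ∈ padicMultiples p m) :
    (p : ℚ) * x ∈ padicMultiples p (m + 1) := by
  rw [add_comm]
  simpa using pow_mul_mem 1 hx

theorem of_pow_mul_mem (h : (p : ℚ) ^ m * x ∈ padicMultiples p (m + n)) :
    x ∈ padicMultiples p n := by
  obtain ⟨r, hr, h⟩ := h
  refine ⟨r, hr, ?_⟩
  have hp0 : (p : ℚ) ^ m ≠ 0 := pow_ne_zero _ (by exact_mod_cast hp.out.ne_zero)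
  rw [pow_add, mul_assoc] at h
  exact mul_left_cancel₀ hp0 h

theorem mono (h : m ≤ n) : padicMultiples p n ≤ padicMultiples p m := by
  obtain ⟨d, rfl⟩ := Nat.exists_eq_add_of_le h
  rintro _ ⟨r, hr, rfl⟩
  rw [pow_add, mul_assoc]
  have hd : (p : ℚ) ^ d ∈ padicMultiples p 0 := by exact_mod_cast natCast_mem (p ^ d)
  exact pow_mul_mem (m := 0) m (mul_mem_left hd ⟨r, hr, by simp⟩)

theorem pow_mem (hx : x ∈ padicMultiples p 0) (k : ℕ) : x ^ k ∈ padicMultiples p 0 := by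
  induction k with
  | zero => simpa using one_mem
  | succ k ih => simpa [pow_succ] using mul_mem ih hx

theorem inv_natCast_mem {k : ℕ} (hk : ¬ p ∣ k) : (k : ℚ)⁻¹ ∈ padicMultiples p 0 := by
  refine ⟨(k : ℚ)⁻¹, fun h => hk ?_, by simp⟩
  have hk0 : 0 < k := Nat.pos_of_ne_zero (by rintro rfl; simp at hk)
  rwa [Rat.inv_natCast_den_of_pos hk0] at h

/-- A `p`-adic unit may be cancelled. -/
theorem of_natCast_mul_mem {k : ℕ} (hk : ¬ p ∣ k) (h : (k : ℚ) * x ∈ padicMultiples p n) :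
    x ∈ padicMultiples p n := by
  have hk0 : (k : ℚ) ≠ 0 := by rintro h0; simp [Nat.cast_eq_zero.1 h0] at hk
  simpa [hk0] using mul_mem_left (inv_natCast_mem hk) h

theorem natCast_mem_of_dvd {k : ℕ} (h : p ^ n ∣ k) : (k : ℚ) ∈ padicMultiples p n := by
  obtain ⟨c, rfl⟩ := h
  push_cast
  exact mul_mem_right (pow_self_mem n) (natCast_mem c)

end padicMultiples

theorem ratCongr_iff {p n : ℕ} [Fact p.Prime] {x y : ℚ} :
    RatCongr p n x y ↔ x - y ∈ padicMultiples p n := Iff.rfl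

open padicMultiples

section residues

section reflection

variable {p k : ℕ}

theorem sub_mem_Icc (hk : k ∈ Icc 1 (p - 1)) : p - k ∈ Icc 1 (p - 1) := by
  rw [mem_Icc] at *
  omega

theorem cast_sub_of_mem_Icc (hk : k ∈ Icc 1 (p - 1)) : ((p - k : ℕ) : ℚ) = p - k := by
  rw [mem_Icc] at hk
  exact Nat.cast_sub (by omega)

theorem sum_Icc_reflect (f : ℕ → ℚ) :
    ∑ k ∈ Icc 1 (p - 1), f (p - k) = ∑ k ∈ Icc 1 (p - 1), f k := by
  refine sum_nbij' (fun k => p - k) (fun k => p - k) ?_ ?_ ?_ ?_ ?_ <;>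
    (intro k hk; try exact sub_mem_Icc hk) <;> rw [mem_Icc] at hk <;> try omega

/-- The relation between the reciprocals of `k` and of `p - k` from which all expansions in powers
of `p` are read off. -/
theorem one_div_sub_eq (hk : k ∈ Icc 1 (p - 1)) :
    1 / ((p : ℚ) - k) = 1 / (k : ℚ) * (p * (1 / ((p : ℚ) - k)) - 1) := by
  rw [mem_Icc] at hk
  have h1 : (k : ℚ) ≠ 0 := by exact_mod_cast (by omega : k ≠ 0)
  have h2 : (p : ℚ) - k ≠ 0 := by
    rw [sub_ne_zero]
    exact_mod_cast (by omega : p ≠ k)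
  field_simp
  ring

end reflection

variable {p : ℕ} [hp : Fact p.Prime] {k : ℕ}

theorem not_dvd_of_mem_Icc (hk : k ∈ Icc 1 (p - 1)) : ¬ p ∣ k := by
  have := hp.out.two_le
  rw [mem_Icc] at hk
  exact Nat.not_dvd_of_pos_of_lt hk.1 (by omega)

theorem one_div_mem (hk : k ∈ Icc 1 (p - 1)) : 1 / (k : ℚ) ∈ padicMultiples p 0 := by
  rw [one_div]
  exact inv_natCast_mem (not_dvd_of_mem_Icc hk)

theorem one_div_pow_mem (hk : k ∈ Icc 1 (p - 1)) (a : ℕ) :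
    1 / (k : ℚ) ^ a ∈ padicMultiples p 0 := by
  rw [← one_div_pow]
  exact pow_mem (one_div_mem hk) a

theorem harmonicSum_mem {n : ℕ} (hn : n ≤ p - 1) (a : ℕ) :
    harmonicSum n a ∈ padicMultiples p 0 :=
  sum_mem fun _ hk => one_div_pow_mem (Icc_subset_Icc le_rfl hn hk) a

theorem one_div_sub_mem (hk : k ∈ Icc 1 (p - 1)) : 1 / ((p : ℚ) - k) ∈ padicMultiples p 0 := by
  rw [← cast_sub_of_mem_Icc hk]
  exact one_div_mem (sub_mem_Icc hk)

theorem pow_card_sub_one_sub_one_mem (hk : k ∈ Icc 1 (p - 1)) :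
    (k : ℚ) ^ (p - 1) - 1 ∈ padicMultiples p 1 := by
  have h := Nat.ModEq.pow_totient (((Nat.Prime.coprime_iff_not_dvd hp.out).2
    (not_dvd_of_mem_Icc hk)).symm)
  rw [Nat.totient_prime hp.out] at h
  have hk1 : 1 ≤ k ^ (p - 1) := Nat.one_le_pow _ _ (mem_Icc.1 hk).1
  have h2 := (Nat.modEq_iff_dvd' hk1).1 h.symm
  have h3 : ((k ^ (p - 1) - 1 : ℕ) : ℚ) ∈ padicMultiples p 1 :=
    natCast_mem_of_dvd (by simpa using h2)
  rwa [Nat.cast_sub hk1, Nat.cast_pow, Nat.cast_one] at h3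

theorem sum_pow_mem {e : ℕ} (h1 : 1 ≤ e) (h2 : e < p - 1) :
    ∑ k ∈ Icc 1 (p - 1), (k : ℚ) ^ e ∈ padicMultiples p 1 := by
  have h : (p : ℕ) ^ 1 ∣ ∑ k ∈ Icc 1 (p - 1), k ^ e := by
    rw [pow_one, ← ZMod.natCast_eq_zero_iff]
    have h3 := FiniteField.sum_pow_lt_card_sub_one (ZMod p) e (by rwa [ZMod.card])
    rw [← h3]
    push_cast
    have h4 : ∑ k ∈ range p, ((k : ℕ) : ZMod p) ^ e = ∑ x : ZMod p, x ^ e := by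
      refine sum_bij (fun k _ => (k : ZMod p)) (fun _ _ => mem_univ _) ?_ ?_ (fun _ _ => rfl)
      · intro a ha b hb hab
        rw [ZMod.natCast_eq_natCast_iff'] at hab
        rwa [Nat.mod_eq_of_lt (mem_range.1 ha), Nat.mod_eq_of_lt (mem_range.1 hb)] at hab
      · intro b _
        exact ⟨b.val, mem_range.2 (ZMod.val_lt b), by simp⟩
    rw [← h4]
    refine sum_subset ?_ ?_
    · intro k hk
      rw [mem_Icc] at hk
      rw [mem_range]
      omega
    · intro k hk hk'
      rw [mem_range] at hk
      rw [mem_Icc] at hk'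
      obtain rfl : k = 0 := by omega
      simp [show e ≠ 0 by omega]
  simpa using natCast_mem_of_dvd h

/-- `∑ k ^ e` over the nonzero residues modulo `p`, with a possibly negative exponent `e ≠ 0`,
`|e| < p - 1`, is divisible by `p`. -/
theorem sum_zpow_mem {e : ℤ} (h0 : e ≠ 0) (h1 : -((p - 1 : ℕ) : ℤ) < e)
    (h2 : e < ((p - 1 : ℕ) : ℤ)) :
    ∑ k ∈ Icc 1 (p - 1), (k : ℚ) ^ e ∈ padicMultiples p 1 := by
  rcases lt_or_gt_of_ne h0 with h | h
  · obtain ⟨a, ha⟩ := Int.eq_ofNat_of_zero_le (show 0 ≤ -e by omega)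
    obtain rfl : e = -(a : ℤ) := by omega
    have key : ∑ k ∈ Icc 1 (p - 1), (k : ℚ) ^ (-(a : ℤ)) =
        ∑ k ∈ Icc 1 (p - 1), (k : ℚ) ^ (p - 1 - a) -
          ∑ k ∈ Icc 1 (p - 1), 1 / (k : ℚ) ^ a * ((k : ℚ) ^ (p - 1) - 1) := by
      rw [← sum_sub_distrib]
      refine sum_congr rfl fun k hk => ?_
      have hk0 : (k : ℚ) ≠ 0 := by exact_mod_cast (by have := mem_Icc.1 hk; omega : k ≠ 0)
      have hpa : (k : ℚ) ^ (p - 1) = (k : ℚ) ^ (p - 1 - a) * (k : ℚ) ^ a := by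
        rw [← pow_add]
        congr 1
        omega
      rw [hpa, zpow_neg, zpow_natCast]
      field_simp
      ring
    rw [key]
    exact sub_mem (sum_pow_mem (by omega) (by omega)) (sum_mem fun k hk =>
      mul_mem_left (one_div_pow_mem hk a) (pow_card_sub_one_sub_one_mem hk))
  · obtain ⟨a, rfl⟩ := Int.eq_ofNat_of_zero_le h.le
    simp only [zpow_natCast]
    exact sum_pow_mem (by omega) (by omega)

theorem harmonicSum_mem_one {a : ℕ} (h1 : 1 ≤ a) (h2 : a < p - 1) :
    harmonicSum (p - 1) a ∈ padicMultiples p 1 := by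
  have h := sum_zpow_mem (p := p) (e := -(a : ℤ)) (by omega) (by omega) (by omega)
  simpa [harmonicSum] using h

theorem bernoulli_mem {n : ℕ} (hn : n < p - 1) : bernoulli n ∈ padicMultiples p 0 := by
  induction n using Nat.strong_induction_on with
  | _ n ih =>
    have h := sum_bernoulli (n + 1)
    rw [sum_range_succ, Nat.choose_succ_self_right] at h
    refine of_natCast_mul_mem (k := n + 1) (Nat.not_dvd_of_pos_of_lt (by omega) (by omega)) ?_
    rw [eq_sub_of_add_eq' h]
    refine sub_mem ?_ (sum_mem fun k hk => ?_)
    · split_ifs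
      exacts [one_mem, zero_mem _]
    · rw [mem_range] at hk
      exact mul_mem_left (natCast_mem _) (ih k hk (by omega))

end residues

/-! ### Exact identities from WZ pairs -/

theorem sum_Icc_one_eq_sum_range (f : ℕ → ℚ) (n : ℕ) :
    ∑ k ∈ Icc 1 n, f k = ∑ i ∈ range n, f (i + 1) := by
  induction n with
  | zero => simp
  | succ n ih => rw [sum_Icc_succ_top (by omega), ih, sum_range_succ]

theorem harmonicSum_succ (n a : ℕ) :
    harmonicSum (n + 1) a = harmonicSum n a + 1 / ((n : ℚ) + 1) ^ a := by
  rw [harmonicSum, sum_Icc_succ_top (by omega)]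
  simp [harmonicSum]

/-- The partial product `∏_{j=1}^{i} (1 - x ^ 2 / j ^ 2)` of `sin (π x) / (π x)`. -/
def sineProduct (x : ℚ) (i : ℕ) : ℚ :=
  ∏ j ∈ range i, (1 - x ^ 2 / ((j : ℚ) + 1) ^ 2)

/-- At an integer `n > i` the partial sine product is a quotient of factorials; here
`n = i + 1 + d`. -/
theorem sineProduct_natCast (i d : ℕ) :
    sineProduct ((i + 1 + d : ℕ) : ℚ) i * ((i + 1 + d : ℕ) * d.factorial * i.factorial ^ 2) =
      (-1) ^ i * (2 * i + 1 + d).factorial := by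
  induction i generalizing d with
  | zero =>
    simp only [sineProduct, range_zero, prod_empty, Nat.factorial]
    rw [show 2 * 0 + 1 + d = d + 1 by ring, Nat.factorial_succ]
    push_cast
    ring
  | succ i ih =>
    have h := ih (d + 1)
    rw [show i + 1 + (d + 1) = i + 1 + 1 + d by ring,
      show 2 * i + 1 + (d + 1) = 2 * i + d + 2 by ring, Nat.factorial_succ d] at h
    rw [show 2 * (i + 1) + 1 + d = 2 * i + d + 2 + 1 by ring, Nat.factorial_succ (2 * i + d + 2),
      Nat.factorial_succ i, sineProduct, prod_range_succ, ← sineProduct]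
    have hi : (i : ℚ) + 1 ≠ 0 := by positivity
    have e : (1 - ((i + 1 + 1 + d : ℕ) : ℚ) ^ 2 / ((i : ℚ) + 1) ^ 2) * ((i : ℚ) + 1) ^ 2 =
        -((d + 1) * (2 * i + d + 3)) := by
      push_cast
      field_simp
      ring
    push_cast at h e ⊢
    linear_combination (-(2 * (i : ℚ) + d + 3)) * h +
      sineProduct ((i : ℚ) + 1 + 1 + d) i * (i + 1 + 1 + d) * d.factorial * i.factorial ^ 2 * e

/-- The terminating Gauss sum `₂F₁(1 - n, 1 + n; 2; 1)`, proved by a WZ pair in `n`. -/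
theorem sum_alternating_choose (n : ℕ) :
    ∑ i ∈ range (n + 1), (-1 : ℚ) ^ (n + i) * (n + 1 + i).factorial /
      ((i + 1).factorial * i.factorial * (n - i).factorial) = 1 := by
  induction n with
  | zero => simp
  | succ n ih =>
    -- the certificate of the WZ pair
    let g : ℕ → ℚ := fun i => (2 * n + 3) / ((n + 1) * (n + 2)) * ((-1) ^ (n + i) *
      (n + 1 + i).factorial * i / (i.factorial ^ 2 * (n + 1 - i).factorial))
    have key : ∀ i ∈ range (n + 1),
        (-1 : ℚ) ^ (n + 1 + i) * (n + 1 + 1 + i).factorial /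
          ((i + 1).factorial * i.factorial * (n + 1 - i).factorial) -
        (-1 : ℚ) ^ (n + i) * (n + 1 + i).factorial /
          ((i + 1).factorial * i.factorial * (n - i).factorial) = g (i + 1) - g i := by
      intro i hi
      obtain ⟨d, rfl⟩ := Nat.exists_eq_add_of_le (Nat.lt_succ_iff.1 (mem_range.1 hi))
      simp only [g]
      rw [show i + d + 1 - i = d + 1 by omega, show i + d - i = d by omega,
        show i + d + 1 - (i + 1) = d by omega,
        show i + d + 1 + 1 + i = 2 * i + d + 1 + 1 by ring,
        show i + d + 1 + (i + 1) = 2 * i + d + 1 + 1 by ring,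
        show i + d + 1 + i = 2 * i + d + 1 by ring, Nat.factorial_succ (2 * i + d + 1),
        Nat.factorial_succ i, Nat.factorial_succ d]
      have h1 : (i.factorial : ℚ) ≠ 0 := by positivity
      have h2 : (d.factorial : ℚ) ≠ 0 := by positivity
      have h3 : (i : ℚ) + 1 ≠ 0 := by positivity
      have h4 : (d : ℚ) + 1 ≠ 0 := by positivity
      have h5 : (i : ℚ) + d + 1 ≠ 0 := by positivity
      have h6 : (i : ℚ) + d + 2 ≠ 0 := by positivity
      push_cast
      field_simp
      ring
    have hs := sum_congr rfl key
    rw [sum_sub_distrib, sum_range_sub, ih] at hs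
    rw [sum_range_succ, eq_add_of_sub_eq hs]
    simp only [g]
    rw [Nat.sub_self, show n + 1 + 1 + (n + 1) = 2 * n + 2 + 1 by ring,
      show n + 1 + (n + 1) = 2 * n + 2 by ring, show n + (n + 1) = 2 * n + 1 by ring,
      Nat.factorial_succ (2 * n + 2), Nat.factorial_succ (n + 1)]
    have h1 : ((n + 1).factorial : ℚ) ≠ 0 := by positivity
    have h2 : (-1 : ℚ) ^ (2 * n + 1) = -1 := Odd.neg_one_pow ⟨n, by ring⟩
    have h3 : (-1 : ℚ) ^ (2 * n + 2) = 1 := Even.neg_one_pow ⟨n + 1, by ring⟩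
    rw [h2, h3]
    push_cast
    field_simp
    ring

/-- `∑_{k=1}^{n} (1 / k) ∏_{j<k} (1 - n ^ 2 / j ^ 2) = (-1) ^ (n - 1) / n`. -/
theorem sum_sineProduct_div (n : ℕ) :
    ∑ i ∈ range (n + 1), 1 / ((i : ℚ) + 1) * sineProduct ((n + 1 : ℕ) : ℚ) i =
      (-1) ^ n / ((n : ℚ) + 1) := by
  have h := congrArg (fun s : ℚ => (-1) ^ n / ((n : ℚ) + 1) * s) (sum_alternating_choose n)
  simp only [mul_one, mul_sum] at h
  rw [← h]
  clear h
  refine sum_congr rfl fun i hi => ?_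
  obtain ⟨d, rfl⟩ := Nat.exists_eq_add_of_le (Nat.lt_succ_iff.1 (mem_range.1 hi))
  have h := sineProduct_natCast i d
  rw [show i + d + 1 + i = 2 * i + 1 + d by ring, show i + d - i = d by omega,
    Nat.factorial_succ i, show i + d + 1 = i + 1 + d by ring]
  have h1 : (i.factorial : ℚ) ≠ 0 := by positivity
  have h2 : (d.factorial : ℚ) ≠ 0 := by positivity
  have h3 : (i : ℚ) + 1 ≠ 0 := by positivity
  have h5 : (i : ℚ) + d + 1 ≠ 0 := by positivity
  have h6 : (-1 : ℚ) ^ (i + d) * (-1) ^ (i + d) = 1 := by rw [← mul_pow]; simp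
  rw [pow_add] at h6 ⊢
  push_cast at h ⊢
  field_simp
  rw [show (i : ℚ) + 1 + d = i + d + 1 by ring] at h ⊢
  linear_combination h - (-1 : ℚ) ^ i * (2 * i + 1 + d).factorial * h6

/-- The finite form of Leshchiner's series for `ζ(4)`. It is the coefficient of `a ^ 2` in the sum
over `1 ≤ k ≤ n` of the WZ pair with kernel
`(-1) ^ (n + k) (1 - a)_{k - 1} (1 + a)_{k - 1} (n - k)! / (n + k)!`. -/
theorem sum_inv_choose_eq (n : ℕ) :
    ∑ i ∈ range n, (4 / (((i : ℚ) + 1) ^ 4 * (2 * (i + 1)).choose (i + 1)) -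
        3 * (harmonicSum i 2 / (((i : ℚ) + 1) ^ 2 * (2 * (i + 1)).choose (i + 1)))) =
      2 * ∑ i ∈ range n, (-1) ^ i / ((i : ℚ) + 1) ^ 4 +
      ∑ i ∈ range n, (-1) ^ (n + i + 1) * i.factorial ^ 2 * (n - 1 - i).factorial /
        (n + i + 1).factorial * harmonicSum i 2 := by
  induction n with
  | zero => simp
  | succ n ih =>
    let g : ℕ → ℚ := fun i => (2 / ((n : ℚ) + 1) ^ 3 - 2 / ((n : ℚ) + 1) * harmonicSum i 2) *
      ((-1) ^ (n + i) * i.factorial ^ 2 * (n - i).factorial / (n + 1 + i).factorial)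
    have key : ∀ i ∈ range n,
        (-1) ^ (n + 1 + i + 1) * i.factorial ^ 2 * (n + 1 - 1 - i).factorial /
            (n + 1 + i + 1).factorial * harmonicSum i 2 -
          (-1) ^ (n + i + 1) * i.factorial ^ 2 * (n - 1 - i).factorial /
            (n + i + 1).factorial * harmonicSum i 2 = g (i + 1) - g i := by
      intro i hi
      obtain ⟨d, rfl⟩ := Nat.exists_eq_add_of_le (Nat.succ_le_of_lt (mem_range.1 hi))
      simp only [g, harmonicSum_succ]
      rw [show i.succ + d + 1 - 1 - i = d + 1 by omega, show i.succ + d - 1 - i = d by omega,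
        show i.succ + d - (i + 1) = d by omega, show i.succ + d - i = d + 1 by omega,
        show i.succ + d + 1 + i + 1 = 2 * i + d + 2 + 1 by simp; ring,
        show i.succ + d + i + 1 = 2 * i + d + 2 by simp; ring,
        show i.succ + d + 1 + (i + 1) = 2 * i + d + 2 + 1 by simp; ring,
        show i.succ + d + 1 + i = 2 * i + d + 2 by simp; ring,
        show i.succ + d + (i + 1) = 2 * i + d + 2 by simp; ring,
        show i.succ + d + i = 2 * i + d + 1 by simp; ring,
        Nat.factorial_succ (2 * i + d + 2), Nat.factorial_succ i, Nat.factorial_succ d]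
      have h1 : ((2 * i + d + 2).factorial : ℚ) ≠ 0 := by positivity
      have h3 : (i : ℚ) + 1 ≠ 0 := by positivity
      have h5 : (i : ℚ) + 1 + d + 1 ≠ 0 := by positivity
      have h6 : (2 * i : ℚ) + d + 2 + 1 ≠ 0 := by positivity
      push_cast
      field_simp
      ring
    have hs := sum_congr rfl key
    rw [sum_sub_distrib, sum_range_sub] at hs
    rw [sum_range_succ, ih, sum_range_succ (fun i : ℕ => (-1) ^ i / ((i : ℚ) + 1) ^ 4),
      sum_range_succ _ n, eq_add_of_sub_eq hs]
    have hc : ((2 * (n + 1)).choose (n + 1) : ℚ) * (n + 1).factorial ^ 2 =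
        (2 * n + 1 + 1).factorial := by
      have := Nat.choose_mul_factorial_mul_factorial (show n + 1 ≤ 2 * (n + 1) by omega)
      rw [show 2 * (n + 1) - (n + 1) = n + 1 by omega] at this
      rw [show 2 * n + 1 + 1 = 2 * (n + 1) by ring, ← this]
      push_cast
      ring
    have hc0 : ((2 * (n + 1)).choose (n + 1) : ℚ) ≠ 0 := by
      exact_mod_cast (Nat.choose_pos (by omega)).ne'
    have hf : ((2 * n + 1).factorial : ℚ) ≠ 0 := by positivity
    have hn : (n : ℚ) + 1 ≠ 0 := by positivity
    have hg0 : g 0 = 2 * (-1) ^ n / ((n : ℚ) + 1) ^ 4 := by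
      have : (n.factorial : ℚ) ≠ 0 := by positivity
      simp [g, harmonicSum, Nat.factorial_succ]
      field_simp
    have e2 : (-1 : ℚ) ^ (2 * n) = 1 := Even.neg_one_pow ⟨n, by ring⟩
    have e3 : (-1 : ℚ) ^ (2 * n + 2) = 1 := Even.neg_one_pow ⟨n + 1, by ring⟩
    have hgn : g n = (2 / ((n : ℚ) + 1) ^ 3 - 2 / ((n : ℚ) + 1) * harmonicSum n 2) *
        (n.factorial ^ 2 / (2 * n + 1).factorial) := by
      simp only [g]
      rw [show n + n = 2 * n by ring, e2, Nat.sub_self, show n + 1 + n = 2 * n + 1 by ring]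
      simp
    rw [hg0, hgn, show n + 1 + n + 1 = 2 * n + 1 + 1 by ring, show n + 1 - 1 - n = 0 by omega,
      show 2 * n + 1 + 1 = 2 * n + 2 by ring, e3, show 2 * n + 2 = 2 * n + 1 + 1 by ring]
    rw [Nat.factorial_succ n, Nat.factorial_succ (2 * n + 1)] at hc
    rw [Nat.factorial_succ (2 * n + 1), Nat.factorial_zero]
    have hn2 : (2 * n : ℚ) + 1 + 1 ≠ 0 := by positivity
    push_cast at hc ⊢
    generalize ((2 * (n + 1)).choose (n + 1) : ℚ) = C at hc hc0 ⊢
    -- express the binomial coefficient through factorials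
    have hnf : (n.factorial : ℚ) ≠ 0 := by positivity
    obtain rfl : C =
        (2 * n + 1 + 1) * (2 * n + 1).factorial / (((n : ℚ) + 1) * n.factorial) ^ 2 := by
      rw [eq_div_iff (by positivity), hc]
    field_simp
    ring

/-! ### Congruences for harmonic sums from the reflection `k ↦ p - k` -/

theorem harmonicSum_reflect (p a : ℕ) :
    harmonicSum (p - 1) a = ∑ k ∈ Icc 1 (p - 1), 1 / ((p : ℚ) - k) ^ a := by
  rw [harmonicSum, ← sum_Icc_reflect]
  exact sum_congr rfl fun k hk => by rw [cast_sub_of_mem_Icc hk]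

section reflection

variable {p : ℕ} [hp : Fact p.Prime] {k : ℕ}

theorem natCast_self_mem : (p : ℚ) ∈ padicMultiples p 1 := by
  simpa using pow_self_mem (p := p) 1

theorem one_div_add_one_div_sub_mem (hk : k ∈ Icc 1 (p - 1)) :
    1 / (k : ℚ) + 1 / ((p : ℚ) - k) ∈ padicMultiples p 1 := by
  have h := one_div_sub_eq hk
  rw [show 1 / (k : ℚ) + 1 / ((p : ℚ) - k) = p * (1 / (k : ℚ) * (1 / ((p : ℚ) - k))) by
    linear_combination h]
  exact self_mul_mem (mul_mem (one_div_mem hk) (one_div_sub_mem hk))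

theorem one_div_sub_pow_four_mem (hk : k ∈ Icc 1 (p - 1)) :
    1 / ((p : ℚ) - k) ^ 4 - 1 / (k : ℚ) ^ 4 - 4 * p * (1 / (k : ℚ) ^ 5) ∈ padicMultiples p 2 := by
  have h := one_div_sub_eq hk
  have hx := one_div_mem hk
  have hy := one_div_sub_mem hk
  simp only [← one_div_pow]
  set x := 1 / (k : ℚ)
  set y := 1 / ((p : ℚ) - k)
  have hr : x ^ 4 * (6 * y ^ 2 - 4 * p * y ^ 3 + p ^ 2 * y ^ 4) - 4 * x ^ 5 * y ∈
      padicMultiples p 0 := by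
    have hp' := natCast_mem (p := p) p
    refine sub_mem (mul_mem_left (pow_mem hx 4) (add_mem (sub_mem ?_ ?_) ?_)) ?_
    · exact mul_mem (ofNat_mem 6) (pow_mem hy 2)
    · exact mul_mem (mul_mem (ofNat_mem 4) hp') (pow_mem hy 3)
    · exact mul_mem (pow_mem hp' 2) (pow_mem hy 4)
    · exact mul_mem (mul_mem (ofNat_mem 4) (pow_mem hx 5)) hy
  rw [show y ^ 4 - x ^ 4 - 4 * p * x ^ 5 =
      p ^ 2 * (x ^ 4 * (6 * y ^ 2 - 4 * p * y ^ 3 + p ^ 2 * y ^ 4) - 4 * x ^ 5 * y) by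
    linear_combination (y ^ 3 + y ^ 2 * (x * (p * y - 1)) + y * (x * (p * y - 1)) ^ 2 +
      (x * (p * y - 1)) ^ 3 - 4 * p * x ^ 4) * h]
  exact pow_mul_mem 2 hr

theorem one_div_sub_pow_three_mem (hk : k ∈ Icc 1 (p - 1)) :
    1 / ((p : ℚ) - k) ^ 3 + 1 / (k : ℚ) ^ 3 + 3 * p * (1 / (k : ℚ) ^ 4) +
      6 * p ^ 2 * (1 / (k : ℚ) ^ 5) ∈ padicMultiples p 3 := by
  have h := one_div_sub_eq hk
  have hx := one_div_mem hk
  have hy := one_div_sub_mem hk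
  simp only [← one_div_pow]
  set x := 1 / (k : ℚ)
  set y := 1 / ((p : ℚ) - k)
  have hr : x ^ 3 * y ^ 3 + 9 * x ^ 5 * y - 3 * p * x ^ 5 * y ^ 2 ∈ padicMultiples p 0 := by
    refine sub_mem (add_mem (mul_mem (pow_mem hx 3) (pow_mem hy 3)) ?_) ?_
    · exact mul_mem (mul_mem (ofNat_mem 9) (pow_mem hx 5)) hy
    · exact mul_mem (mul_mem (mul_mem (ofNat_mem 3) (natCast_mem p)) (pow_mem hx 5)) (pow_mem hy 2)
  rw [show y ^ 3 + x ^ 3 + 3 * p * x ^ 4 + 6 * p ^ 2 * x ^ 5 =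
      p ^ 3 * (x ^ 3 * y ^ 3 + 9 * x ^ 5 * y - 3 * p * x ^ 5 * y ^ 2) by
    linear_combination (y ^ 2 + y * (x * (p * y - 1)) + (x * (p * y - 1)) ^ 2 + 3 * p * x ^ 3 +
      3 * p ^ 2 * x ^ 4 - 3 * p ^ 2 * x ^ 3 * (y + x * (p * y - 1))) * h]
  exact pow_mul_mem 3 hr

theorem two_mul_harmonicSum_one_mem :
    2 * harmonicSum (p - 1) 1 + p * harmonicSum (p - 1) 2 + p ^ 2 * harmonicSum (p - 1) 3 +
      p ^ 3 * harmonicSum (p - 1) 4 + p ^ 4 * harmonicSum (p - 1) 5 ∈ padicMultiples p 5 := by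
  have key : 2 * harmonicSum (p - 1) 1 + p * harmonicSum (p - 1) 2 +
      p ^ 2 * harmonicSum (p - 1) 3 + p ^ 3 * harmonicSum (p - 1) 4 +
      p ^ 4 * harmonicSum (p - 1) 5 =
      ∑ k ∈ Icc 1 (p - 1), (p : ℚ) ^ 5 * ((1 / (k : ℚ)) ^ 5 * (1 / ((p : ℚ) - k))) := by
    rw [two_mul]
    nth_rw 2 [harmonicSum_reflect]
    simp only [harmonicSum, mul_sum, ← sum_add_distrib]
    refine sum_congr rfl fun k hk => ?_
    have h := one_div_sub_eq hk
    simp only [← one_div_pow]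
    set x := 1 / (k : ℚ)
    set y := 1 / ((p : ℚ) - k)
    linear_combination (1 + p * x + p ^ 2 * x ^ 2 + p ^ 3 * x ^ 3 + p ^ 4 * x ^ 4) * h
  rw [key]
  exact sum_mem fun k hk =>
    pow_mul_mem 5 (mul_mem (pow_mem (one_div_mem hk) 5) (one_div_sub_mem hk))

theorem two_mul_harmonicSum_three_mem (h7 : 7 ≤ p) :
    2 * harmonicSum (p - 1) 3 + 3 * p * harmonicSum (p - 1) 4 ∈ padicMultiples p 3 := by
  have key : 2 * harmonicSum (p - 1) 3 + 3 * p * harmonicSum (p - 1) 4 =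
      ∑ k ∈ Icc 1 (p - 1), (1 / ((p : ℚ) - k) ^ 3 + 1 / (k : ℚ) ^ 3 + 3 * p * (1 / (k : ℚ) ^ 4) +
        6 * p ^ 2 * (1 / (k : ℚ) ^ 5)) - 6 * (p ^ 2 * harmonicSum (p - 1) 5) := by
    rw [two_mul]
    nth_rw 1 [harmonicSum_reflect]
    simp only [harmonicSum, sum_add_distrib, mul_sum, mul_assoc, sub_eq_add_neg]
    ring
  rw [key]
  exact sub_mem (sum_mem fun k hk => one_div_sub_pow_three_mem hk)
    (mul_mem_left (ofNat_mem 6) (pow_mul_mem 2 (harmonicSum_mem_one (by omega) (by omega))))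

/-- The double harmonic sum `∑_{1 ≤ j < k ≤ n} 1 / (j ^ a k ^ b)`. -/
def doubleHarmonicSum (n a b : ℕ) : ℚ :=
  ∑ k ∈ Icc 1 n, harmonicSum (k - 1) a / (k : ℚ) ^ b

theorem harmonicSum_sub_one_mem (hk : k ∈ Icc 1 (p - 1)) (a : ℕ) :
    harmonicSum (k - 1) a ∈ padicMultiples p 0 :=
  harmonicSum_mem (by rw [mem_Icc] at hk; omega) a

theorem doubleHarmonicSum_self (n a : ℕ) :
    doubleHarmonicSum n a a = (harmonicSum n a ^ 2 - harmonicSum n (2 * a)) / 2 := by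
  induction n with
  | zero => simp [doubleHarmonicSum, harmonicSum]
  | succ n ih =>
    rw [doubleHarmonicSum, sum_Icc_succ_top (by omega), ← doubleHarmonicSum, ih,
      harmonicSum_succ, harmonicSum_succ, pow_mul']
    have : ((n : ℚ) + 1) ^ a ≠ 0 := by positivity
    push_cast
    field_simp
    ring

theorem harmonicSum_two_add_mem (h5 : 5 ≤ p) (hk : k ≤ p - 1) :
    harmonicSum (p - 1 - k) 2 + harmonicSum k 2 ∈ padicMultiples p 1 := by
  induction k with
  | zero =>
    simpa [harmonicSum] using harmonicSum_mem_one (p := p) (a := 2) (by omega) (by omega)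
  | succ k ih =>
    have hk1 : k + 1 ∈ Icc 1 (p - 1) := mem_Icc.2 ⟨by omega, hk⟩
    have h := ih (by omega)
    have e : p - 1 - k = (p - 1 - (k + 1)) + 1 := by omega
    have e2 : ((p - 1 - (k + 1) : ℕ) : ℚ) + 1 = (p : ℚ) - (k + 1 : ℕ) := by
      rw [← cast_sub_of_mem_Icc hk1, show p - (k + 1) = (p - 1 - (k + 1)) + 1 by omega]
      push_cast
      rfl
    rw [e, harmonicSum_succ, e2] at h
    rw [harmonicSum_succ]
    have hd := mul_mem_right (one_div_add_one_div_sub_mem hk1)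
      (sub_mem (one_div_mem hk1) (one_div_sub_mem hk1))
    convert add_mem h hd using 1
    simp only [← one_div_pow]
    push_cast
    ring

/-- The triple sums of weight five enter only through `∑ H_{k-1}(2) ^ 2 / k`, and the reflection
`k ↦ p - k` reduces that sum to a double sum modulo `p`. -/
theorem sum_harmonicSum_sq_div_mem (h7 : 7 ≤ p) :
    ∑ k ∈ Icc 1 (p - 1), harmonicSum (k - 1) 2 ^ 2 / (k : ℚ) + doubleHarmonicSum (p - 1) 2 3 ∈
      padicMultiples p 1 := by
  refine of_natCast_mul_mem (k := 2) (Nat.not_dvd_of_pos_of_lt (by omega) (by omega)) ?_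
  have key : ((2 : ℕ) : ℚ) * (∑ k ∈ Icc 1 (p - 1), harmonicSum (k - 1) 2 ^ 2 / (k : ℚ) +
      doubleHarmonicSum (p - 1) 2 3) =
      ∑ k ∈ Icc 1 (p - 1), (harmonicSum (p - k - 1) 2 ^ 2 * (1 / ((p : ℚ) - k)) +
        (harmonicSum (k - 1) 2 + 1 / (k : ℚ) ^ 2) ^ 2 * (1 / (k : ℚ))) -
          harmonicSum (p - 1) 5 := by
    have hr := sum_Icc_reflect (p := p) fun k => harmonicSum (k - 1) 2 ^ 2 / (k : ℚ)
    have hr' : ∑ k ∈ Icc 1 (p - 1), harmonicSum (p - k - 1) 2 ^ 2 * (1 / ((p : ℚ) - k)) =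
        ∑ k ∈ Icc 1 (p - 1), harmonicSum (k - 1) 2 ^ 2 / (k : ℚ) := by
      rw [← hr]
      exact sum_congr rfl fun k hk => by rw [cast_sub_of_mem_Icc hk, mul_one_div]
    rw [sum_add_distrib, hr', doubleHarmonicSum, harmonicSum]
    simp only [mul_add, mul_sum, ← sum_add_distrib, ← sum_sub_distrib]
    refine sum_congr rfl fun k hk => ?_
    push_cast
    ring
  rw [key]
  refine sub_mem (sum_mem fun k hk => ?_) (harmonicSum_mem_one (by omega) (by omega))
  have hk' := mem_Icc.1 hk
  have hu : harmonicSum (p - k - 1) 2 + (harmonicSum (k - 1) 2 + 1 / (k : ℚ) ^ 2) ∈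
      padicMultiples p 1 := by
    have h := harmonicSum_two_add_mem (p := p) (by omega) hk'.2
    obtain ⟨i, rfl⟩ := Nat.exists_eq_add_of_le' hk'.1
    rw [harmonicSum_succ] at h
    rw [show p - (i + 1) - 1 = p - 1 - (i + 1) by omega, Nat.add_sub_cancel]
    simpa using h
  have hs : harmonicSum (k - 1) 2 + 1 / (k : ℚ) ^ 2 ∈ padicMultiples p 0 :=
    add_mem (harmonicSum_sub_one_mem hk 2) (one_div_pow_mem hk 2)
  have hu0 : harmonicSum (p - k - 1) 2 ∈ padicMultiples p 0 := harmonicSum_mem (by omega) 2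
  convert add_mem (mul_mem_right hu (mul_mem (sub_mem hu0 hs) (one_div_sub_mem hk)))
    (mul_mem_left (pow_mem hs 2) (one_div_add_one_div_sub_mem hk)) using 1
  ring

end reflection

/-! ### Sums over half of the residues -/

theorem sum_range_two_mul (f : ℕ → ℚ) (n : ℕ) :
    ∑ i ∈ range (2 * n), f i = ∑ i ∈ range n, (f (2 * i) + f (2 * i + 1)) := by
  induction n with
  | zero => simp
  | succ n ih => rw [mul_add, sum_range_succ, sum_range_succ, ih, sum_range_succ]; ring

/-- For odd `2 n + 1` the odd numbers below it are the reflections of the even ones. -/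
theorem sum_range_odd (f : ℕ → ℚ) (n : ℕ) :
    ∑ i ∈ range n, f (2 * i + 1) = ∑ j ∈ Icc 1 n, f (2 * n + 1 - 2 * j) := by
  rw [sum_Icc_one_eq_sum_range, ← sum_range_reflect]
  refine sum_congr rfl fun i hi => ?_
  rw [mem_range] at hi
  congr 1
  omega

theorem sum_Icc_parity (f : ℕ → ℚ) (n : ℕ) :
    ∑ k ∈ Icc 1 (2 * n), f k = ∑ j ∈ Icc 1 n, (f (2 * n + 1 - 2 * j) + f (2 * j)) := by
  rw [sum_add_distrib, ← sum_range_odd, sum_Icc_one_eq_sum_range, sum_range_two_mul,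
    sum_Icc_one_eq_sum_range, ← sum_add_distrib]
  rfl

theorem sum_alternating_parity (f : ℕ → ℚ) (n : ℕ) :
    ∑ i ∈ range (2 * n), (-1) ^ i * f (i + 1) =
      ∑ j ∈ Icc 1 n, (f (2 * n + 1 - 2 * j) - f (2 * j)) := by
  rw [sum_sub_distrib, ← sum_range_odd, sum_range_two_mul, sum_Icc_one_eq_sum_range,
    ← sum_sub_distrib]
  refine sum_congr rfl fun i _ => ?_
  rw [pow_succ, pow_mul, mul_add]
  simp
  ring

theorem sum_Icc_half (f : ℕ → ℚ) (n : ℕ) :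
    ∑ k ∈ Icc 1 (2 * n), f k = ∑ j ∈ Icc 1 n, (f (2 * n + 1 - j) + f j) := by
  rw [sum_add_distrib, sum_Icc_one_eq_sum_range, sum_Icc_one_eq_sum_range,
    sum_Icc_one_eq_sum_range, two_mul, sum_range_add, add_comm]
  congr 1
  rw [← sum_range_reflect]
  refine sum_congr rfl fun i hi => ?_
  rw [mem_range] at hi
  congr 1
  omega

theorem mem_Icc_of_half {p n : ℕ} (hpn : p = 2 * n + 1) {j : ℕ} (hj : j ∈ Icc 1 n) :
    j ∈ Icc 1 (p - 1) ∧ 2 * j ∈ Icc 1 (p - 1) := by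
  simp only [mem_Icc] at *
  omega

section half

variable {p : ℕ} [hp : Fact p.Prime] {n : ℕ}

theorem harmonicSum_four_half_mem (hpn : p = 2 * n + 1) :
    harmonicSum (p - 1) 4 - (2 * harmonicSum n 4 + 4 * p * harmonicSum n 5) ∈
      padicMultiples p 2 := by
  have key : harmonicSum (p - 1) 4 - (2 * harmonicSum n 4 + 4 * p * harmonicSum n 5) =
      ∑ j ∈ Icc 1 n,
        (1 / ((p : ℚ) - j) ^ 4 - 1 / (j : ℚ) ^ 4 - 4 * p * (1 / (j : ℚ) ^ 5)) := by
    rw [harmonicSum, show p - 1 = 2 * n by omega, sum_Icc_half, harmonicSum, harmonicSum]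
    simp only [mul_sum, ← sum_add_distrib, ← sum_sub_distrib]
    refine sum_congr rfl fun j hj => ?_
    rw [← hpn, cast_sub_of_mem_Icc (mem_Icc_of_half hpn hj).1]
    ring
  rw [key]
  exact sum_mem fun j hj => one_div_sub_pow_four_mem (mem_Icc_of_half hpn hj).1

theorem harmonicSum_four_parity_mem (hpn : p = 2 * n + 1) :
    harmonicSum (p - 1) 4 - (harmonicSum n 4 / 8 + p / 8 * harmonicSum n 5) ∈
      padicMultiples p 2 := by
  have key : harmonicSum (p - 1) 4 - (harmonicSum n 4 / 8 + p / 8 * harmonicSum n 5) =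
      ∑ j ∈ Icc 1 n, (1 / ((p : ℚ) - (2 * j : ℕ)) ^ 4 - 1 / ((2 * j : ℕ) : ℚ) ^ 4 -
        4 * p * (1 / ((2 * j : ℕ) : ℚ) ^ 5)) := by
    rw [harmonicSum, show p - 1 = 2 * n by omega, sum_Icc_parity, harmonicSum, harmonicSum]
    simp only [mul_sum, sum_div, ← sum_add_distrib, ← sum_sub_distrib]
    refine sum_congr rfl fun j hj => ?_
    rw [← hpn, cast_sub_of_mem_Icc (mem_Icc_of_half hpn hj).2]
    push_cast
    ring
  rw [key]
  exact sum_mem fun j hj => one_div_sub_pow_four_mem (mem_Icc_of_half hpn hj).2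

theorem sum_alternating_four_mem (hpn : p = 2 * n + 1) :
    ∑ i ∈ range (p - 1), (-1) ^ i / ((i : ℚ) + 1) ^ 4 - p / 8 * harmonicSum n 5 ∈
      padicMultiples p 2 := by
  have key : ∑ i ∈ range (p - 1), (-1) ^ i / ((i : ℚ) + 1) ^ 4 - p / 8 * harmonicSum n 5 =
      ∑ j ∈ Icc 1 n, (1 / ((p : ℚ) - (2 * j : ℕ)) ^ 4 - 1 / ((2 * j : ℕ) : ℚ) ^ 4 -
        4 * p * (1 / ((2 * j : ℕ) : ℚ) ^ 5)) := by
    have h := sum_alternating_parity (fun k => 1 / (k : ℚ) ^ 4) n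
    push_cast [mul_one_div] at h
    rw [show p - 1 = 2 * n by omega, h, harmonicSum]
    simp only [mul_sum, ← sum_sub_distrib]
    refine sum_congr rfl fun j hj => ?_
    rw [← hpn, cast_sub_of_mem_Icc (mem_Icc_of_half hpn hj).2]
    push_cast
    ring
  rw [key]
  exact sum_mem fun j hj => one_div_sub_pow_four_mem (mem_Icc_of_half hpn hj).2

/-- Eliminating `H_n(4)` from the two evaluations of `H_{p-1}(4)`. -/
theorem harmonicSum_four_add_half_mem (hpn : p = 2 * n + 1) :
    15 * harmonicSum (p - 1) 4 + 2 * p * harmonicSum n 5 ∈ padicMultiples p 2 := by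
  convert sub_mem (mul_mem_left (ofNat_mem 16) (harmonicSum_four_parity_mem hpn))
    (harmonicSum_four_half_mem hpn) using 1
  ring

theorem sum_alternating_add_harmonicSum_mem (hpn : p = 2 * n + 1) :
    2 * ∑ i ∈ range (p - 1), (-1) ^ i / ((i : ℚ) + 1) ^ 4 + 15 / 8 * harmonicSum (p - 1) 4 ∈
      padicMultiples p 2 := by
  have h8 : ¬ p ∣ 8 := by
    rw [show 8 = 2 ^ 3 by norm_num]
    intro h
    have := (Nat.prime_dvd_prime_iff_eq hp.out Nat.prime_two).1 (hp.out.dvd_of_dvd_pow h)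
    omega
  refine of_natCast_mul_mem h8 ?_
  convert add_mem (mul_mem_left (ofNat_mem 16) (sum_alternating_four_mem hpn))
    (harmonicSum_four_add_half_mem hpn) using 1
  push_cast
  ring

end half

/-! ### Faulhaber's formula and Bernoulli numbers -/

section faulhaber

variable {p : ℕ} [hp : Fact p.Prime]

/-- The `i`-th coefficient in Faulhaber's formula for sums of `m`-th powers. -/
def faulhaberCoeff (m i : ℕ) : ℚ := bernoulli i * (m + 1).choose i / (m + 1)

theorem faulhaberCoeff_mem {m i : ℕ} (hm : m + 1 < p) (hi : i ≤ m) :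
    faulhaberCoeff m i ∈ padicMultiples p 0 := by
  rw [faulhaberCoeff, div_eq_mul_inv]
  refine mul_mem_left (mul_mem_left (bernoulli_mem (by omega)) (natCast_mem _)) ?_
  exact_mod_cast inv_natCast_mem (p := p) (k := m + 1)
    (Nat.not_dvd_of_pos_of_lt (by omega) hm)

theorem faulhaberCoeff_self (m : ℕ) : faulhaberCoeff m m = bernoulli m := by
  have : (m : ℚ) + 1 ≠ 0 := by positivity
  rw [faulhaberCoeff, Nat.choose_succ_self_right]
  push_cast
  field_simp

theorem sum_range_pow_eq_faulhaber (n m : ℕ) :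
    ∑ k ∈ range n, (k : ℚ) ^ m =
      ∑ i ∈ range (m + 1), faulhaberCoeff m i * (n : ℚ) ^ (m + 1 - i) := by
  rw [sum_range_pow]
  exact sum_congr rfl fun i _ => by rw [faulhaberCoeff]; ring

theorem sum_Icc_pow_eq_sum_range {m : ℕ} (hm : 1 ≤ m) {n : ℕ} (hn : 1 ≤ n) :
    ∑ k ∈ Icc 1 (n - 1), (k : ℚ) ^ m = ∑ k ∈ range n, (k : ℚ) ^ m := by
  obtain ⟨n, rfl⟩ := Nat.exists_eq_add_of_le' hn
  rw [Nat.add_sub_cancel, sum_Icc_one_eq_sum_range, sum_range_succ']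
  simp [show m ≠ 0 by omega]

theorem sum_pow_sub_bernoulli_mem {m : ℕ} (hm1 : 1 ≤ m) (hm : m + 1 < p) :
    ∑ k ∈ Icc 1 (p - 1), (k : ℚ) ^ m - p * bernoulli m ∈ padicMultiples p 2 := by
  rw [sum_Icc_pow_eq_sum_range hm1 (by omega), sum_range_pow_eq_faulhaber, sum_range_succ,
    faulhaberCoeff_self, show m + 1 - m = 1 by omega, pow_one, mul_comm (p : ℚ),
    add_sub_cancel_right]
  refine sum_mem fun i hi => ?_
  rw [mem_range] at hi
  exact mul_mem_left (faulhaberCoeff_mem hm hi.le)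
    (mono (by omega) (pow_self_mem (p := p) (m + 1 - i)))

/-- A double harmonic sum of weight five modulo `p`: after the inner reciprocal powers are replaced
by positive powers and summed by Faulhaber's formula, only the constant exponent survives the outer
summation. -/
theorem doubleHarmonicSum_add_faulhaberCoeff_mem (h7 : 7 ≤ p) {a b : ℕ} (ha : 1 ≤ a) (hb : 1 ≤ b)
    (hab : a + b = 5) :
    doubleHarmonicSum (p - 1) a b + faulhaberCoeff (p - 1 - a) (p - 5) ∈ padicMultiples p 1 := by
  obtain ⟨m, hm⟩ : ∃ m, p - 1 - a = m := ⟨_, rfl⟩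
  rw [hm]
  have hinner : doubleHarmonicSum (p - 1) a b -
      ∑ k ∈ Icc 1 (p - 1), (∑ j ∈ Icc 1 (k - 1), (j : ℚ) ^ m) * (1 / (k : ℚ) ^ b) ∈
      padicMultiples p 1 := by
    rw [doubleHarmonicSum, ← sum_sub_distrib]
    refine sum_mem fun k hk => ?_
    rw [div_eq_mul_one_div, ← sub_mul, harmonicSum, ← sum_sub_distrib]
    refine mul_mem_right (sum_mem fun j hj => ?_) (one_div_pow_mem hk b)
    have hj' : j ∈ Icc 1 (p - 1) := by
      rw [mem_Icc] at *
      omega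
    have hj0 : (j : ℚ) ≠ 0 := by exact_mod_cast (by have := mem_Icc.1 hj; omega : j ≠ 0)
    have e : 1 / (j : ℚ) ^ a - (j : ℚ) ^ m = -(1 / (j : ℚ) ^ a * ((j : ℚ) ^ (p - 1) - 1)) := by
      rw [show p - 1 = m + a by omega, pow_add]
      field_simp
      ring
    rw [e]
    exact neg_mem (mul_mem_left (one_div_pow_mem hj' a) (pow_card_sub_one_sub_one_mem hj'))
  have hswap : ∑ k ∈ Icc 1 (p - 1), (∑ j ∈ Icc 1 (k - 1), (j : ℚ) ^ m) * (1 / (k : ℚ) ^ b) =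
      ∑ i ∈ range (m + 1), faulhaberCoeff m i *
        ∑ k ∈ Icc 1 (p - 1), (k : ℚ) ^ ((p : ℤ) - 5 - i) := by
    simp only [mul_sum]
    rw [sum_comm]
    refine sum_congr rfl fun k hk => ?_
    have hk' := mem_Icc.1 hk
    have hk0 : (k : ℚ) ≠ 0 := by exact_mod_cast (by omega : k ≠ 0)
    rw [sum_Icc_pow_eq_sum_range (by omega) hk'.1, sum_range_pow_eq_faulhaber, sum_mul]
    refine sum_congr rfl fun i hi => ?_
    rw [mem_range] at hi
    rw [show (p : ℤ) - 5 - i = ((m + 1 - i : ℕ) : ℤ) - (b : ℤ) by omega, zpow_sub₀ hk0,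
      zpow_natCast, zpow_natCast]
    ring
  have houter : ∑ i ∈ range (m + 1), faulhaberCoeff m i *
      ∑ k ∈ Icc 1 (p - 1), (k : ℚ) ^ ((p : ℤ) - 5 - i) + faulhaberCoeff m (p - 5) ∈
      padicMultiples p 1 := by
    rw [← add_sum_erase _ _ (show p - 5 ∈ range (m + 1) by rw [mem_range]; omega),
      add_right_comm]
    refine add_mem ?_ (sum_mem fun i hi => ?_)
    · rw [show (p : ℤ) - 5 - ((p - 5 : ℕ) : ℤ) = 0 by omega]
      simp only [zpow_zero, sum_const, Nat.card_Icc, nsmul_eq_mul, mul_one, Nat.add_sub_cancel]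
      rw [Nat.cast_sub (by omega), Nat.cast_one, mul_sub, mul_one, sub_add_cancel]
      exact mul_mem_left (faulhaberCoeff_mem (by omega) (by omega)) natCast_self_mem
    · rw [mem_erase, mem_range] at hi
      exact mul_mem_left (faulhaberCoeff_mem (by omega) (by omega))
        (sum_zpow_mem (by omega) (by omega) (by omega))
  rw [← hswap] at houter
  convert add_mem hinner houter using 1
  ring

theorem doubleHarmonicSum_four_one_mem (h7 : 7 ≤ p) :
    doubleHarmonicSum (p - 1) 4 1 + bernoulli (p - 5) ∈ padicMultiples p 1 := by
  have h := doubleHarmonicSum_add_faulhaberCoeff_mem (p := p) h7 (a := 4) (b := 1)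
    (by omega) (by omega) rfl
  rwa [show p - 1 - 4 = p - 5 by omega, faulhaberCoeff_self] at h

theorem doubleHarmonicSum_two_three_mem (h7 : 7 ≤ p) :
    doubleHarmonicSum (p - 1) 2 3 + 2 * bernoulli (p - 5) ∈ padicMultiples p 1 := by
  have h := doubleHarmonicSum_add_faulhaberCoeff_mem (p := p) h7 (a := 2) (b := 3)
    (by omega) (by omega) rfl
  have hB : bernoulli (p - 5) ∈ padicMultiples p 0 := bernoulli_mem (by omega)
  have hc : 6 * faulhaberCoeff (p - 1 - 2) (p - 5) =
      bernoulli (p - 5) * ((p - 3) * (p - 4)) := by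
    obtain ⟨q, rfl⟩ := Nat.exists_eq_add_of_le' h7
    rw [faulhaberCoeff, show q + 7 - 1 - 2 = q + 4 by omega, show q + 7 - 5 = q + 2 by omega,
      ← Nat.choose_symm (by omega), show q + 4 + 1 - (q + 2) = 3 by omega]
    have h3 := Nat.descFactorial_eq_factorial_mul_choose (q + 4 + 1) 3
    have h4 : (((q + 4 + 1).descFactorial 3 : ℕ) : ℚ) = (q + 5) * (q + 4) * (q + 3) := by
      simp [Nat.descFactorial, show q + 4 + 1 - 2 = q + 3 by omega]
      ring
    rw [h3] at h4
    push_cast [show Nat.factorial 3 = 6 by rfl] at h4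
    have h5 : (q : ℚ) + 4 + 1 ≠ 0 := by positivity
    push_cast
    field_simp
    linear_combination bernoulli (q + 2) * h4
  have h6 : ¬ p ∣ 6 := Nat.not_dvd_of_pos_of_lt (by omega) (by omega)
  refine of_natCast_mul_mem h6 ?_
  convert add_mem (mul_mem_left (ofNat_mem 6) h) (mul_mem (mul_mem_left hB
    (sub_mem (ofNat_mem 7) (natCast_mem p))) (natCast_self_mem (p := p))) using 1
  push_cast
  linear_combination -hc

theorem sub_pow_succ_mem (k m : ℕ) :
    ((k : ℚ) - p) ^ (m + 1) - (k : ℚ) ^ (m + 1) + (m + 1) * p * (k : ℚ) ^ m ∈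
      padicMultiples p 2 := by
  induction m with
  | zero => simp
  | succ m ih =>
    have hk := natCast_mem (p := p) k
    convert add_mem (mul_mem_right ih (sub_mem hk (natCast_mem p)))
      (mul_mem_right (pow_self_mem 2) (mul_mem (natCast_mem (m + 1)) (pow_mem hk m))) using 1
    push_cast
    ring

theorem even_pow_sub_mem {m : ℕ} (hm : 1 ≤ m) (he : Even m) (k : ℕ) :
    ((p : ℚ) - k) ^ m - (k : ℚ) ^ m + m * p * (k : ℚ) ^ (m - 1) ∈ padicMultiples p 2 := by
  obtain ⟨m, rfl⟩ := Nat.exists_eq_add_of_le' hm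
  rw [← neg_sub (k : ℚ) p, he.neg_pow]
  exact_mod_cast sub_pow_succ_mem (p := p) k m

/-- An elementary replacement for Kummer's congruence: the power sums with exponents `-4` and
`p - 5` are compared by evaluating each of them in two ways through half sums. -/
theorem five_mul_harmonicSum_four_mem (h7 : 7 ≤ p) :
    5 * harmonicSum (p - 1) 4 - 4 * (p * bernoulli (p - 5)) ∈ padicMultiples p 2 := by
  obtain ⟨n, hpn⟩ : ∃ n, p = 2 * n + 1 := hp.out.odd_of_ne_two (by omega)
  obtain ⟨m, hm⟩ : ∃ m, m = p - 5 := ⟨_, rfl⟩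
  have hm1 : 1 ≤ m := by omega
  have hme : Even m := ⟨n - 2, by omega⟩
  rw [← hm]
  have hSB := sum_pow_sub_bernoulli_mem (p := p) hm1 (by omega)
  have hS1 : ∑ k ∈ Icc 1 (p - 1), (k : ℚ) ^ m ∈ padicMultiples p 1 :=
    sum_pow_mem hm1 (by omega)
  have hhalf : ∑ k ∈ Icc 1 (p - 1), (k : ℚ) ^ m - (2 * ∑ j ∈ Icc 1 n, (j : ℚ) ^ m -
      m * p * ∑ j ∈ Icc 1 n, (j : ℚ) ^ (m - 1)) ∈ padicMultiples p 2 := by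
    have key : ∑ k ∈ Icc 1 (p - 1), (k : ℚ) ^ m - (2 * ∑ j ∈ Icc 1 n, (j : ℚ) ^ m -
        m * p * ∑ j ∈ Icc 1 n, (j : ℚ) ^ (m - 1)) =
        ∑ j ∈ Icc 1 n, (((p : ℚ) - j) ^ m - (j : ℚ) ^ m + m * p * (j : ℚ) ^ (m - 1)) := by
      rw [show p - 1 = 2 * n by omega, sum_Icc_half]
      simp only [mul_sum, ← sum_sub_distrib]
      refine sum_congr rfl fun j hj => ?_
      rw [← hpn, cast_sub_of_mem_Icc (mem_Icc_of_half hpn hj).1]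
      ring
    rw [key]
    exact sum_mem fun j _ => even_pow_sub_mem hm1 hme j
  have hparity : ∑ k ∈ Icc 1 (p - 1), (k : ℚ) ^ m - (2 * 2 ^ m * ∑ j ∈ Icc 1 n, (j : ℚ) ^ m -
      m * p * 2 ^ (m - 1) * ∑ j ∈ Icc 1 n, (j : ℚ) ^ (m - 1)) ∈ padicMultiples p 2 := by
    have key : ∑ k ∈ Icc 1 (p - 1), (k : ℚ) ^ m - (2 * 2 ^ m * ∑ j ∈ Icc 1 n, (j : ℚ) ^ m -
        m * p * 2 ^ (m - 1) * ∑ j ∈ Icc 1 n, (j : ℚ) ^ (m - 1)) =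
        ∑ j ∈ Icc 1 n, (((p : ℚ) - (2 * j : ℕ)) ^ m - ((2 * j : ℕ) : ℚ) ^ m +
          m * p * ((2 * j : ℕ) : ℚ) ^ (m - 1)) := by
      rw [show p - 1 = 2 * n by omega, sum_Icc_parity]
      simp only [mul_sum, ← sum_sub_distrib]
      refine sum_congr rfl fun j hj => ?_
      rw [← hpn, cast_sub_of_mem_Icc (mem_Icc_of_half hpn hj).2]
      push_cast
      rw [mul_pow, mul_pow]
      ring
    rw [key]
    exact sum_mem fun j _ => even_pow_sub_mem hm1 hme _
  have ht : ∑ j ∈ Icc 1 n, (j : ℚ) ^ (m - 1) - harmonicSum n 5 ∈ padicMultiples p 1 := by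
    rw [harmonicSum, ← sum_sub_distrib]
    refine sum_mem fun j hj => ?_
    have hj' := (mem_Icc_of_half hpn hj).1
    have hj0 : (j : ℚ) ≠ 0 := by exact_mod_cast (by have := mem_Icc.1 hj; omega : j ≠ 0)
    have e : (j : ℚ) ^ (m - 1) - 1 / (j : ℚ) ^ 5 =
        1 / (j : ℚ) ^ 5 * ((j : ℚ) ^ (p - 1) - 1) := by
      rw [show p - 1 = (m - 1) + 5 by omega, pow_add]
      field_simp
    rw [e]
    exact mul_mem_left (one_div_pow_mem hj' 5) (pow_card_sub_one_sub_one_mem hj')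
  have ht0 : ∑ j ∈ Icc 1 n, (j : ℚ) ^ (m - 1) ∈ padicMultiples p 0 :=
    sum_mem fun j _ => pow_mem (natCast_mem j) _
  have hw : (2 : ℚ) ^ (p - 1) - 1 ∈ padicMultiples p 1 := by
    exact_mod_cast pow_card_sub_one_sub_one_mem (p := p) (k := 2) (mem_Icc.2 (by omega))
  have hg := harmonicSum_four_add_half_mem (p := p) hpn
  have e1 : (2 : ℚ) ^ m = 2 * 2 ^ (m - 1) := by
    rw [← pow_succ']
    congr 1
    omega
  have e2 : (2 : ℚ) ^ (p - 1) = 32 * 2 ^ (m - 1) := by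
    rw [show p - 1 = 5 + (m - 1) by omega, pow_add]
    norm_num
  have e3 : (m : ℚ) = p - 5 := by rw [hm, Nat.cast_sub (by omega)]; norm_num
  have h2 : (2 : ℚ) ^ (m - 1) ∈ padicMultiples p 0 := pow_mem (ofNat_mem 2) _
  generalize ∑ k ∈ Icc 1 (p - 1), (k : ℚ) ^ m = S at *
  generalize ∑ j ∈ Icc 1 n, (j : ℚ) ^ (m - 1) = t at *
  generalize ∑ j ∈ Icc 1 n, (j : ℚ) ^ m = s at *
  rw [e1] at hparity
  rw [e2] at hw
  generalize (2 : ℚ) ^ (m - 1) = v at *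
  -- eliminate the half sum `s`, then replace `2 ^ (p - 1)` by `1`
  have hSt : 30 * S + 5 * p * t ∈ padicMultiples p 2 := by
    have h1 := sub_mem (mul_mem_left (mul_mem (ofNat_mem 64) h2) hhalf)
      (mul_mem_left (ofNat_mem 32) hparity)
    have h3 := mul_mem hw (add_mem (mul_mem_left (ofNat_mem 2) hS1)
      (mul_mem_right natCast_self_mem (mul_mem (natCast_mem m) ht0)))
    have h4 := mul_mem_right (pow_self_mem (p := p) 2) ht0
    convert add_mem (sub_mem h3 h1) h4 using 1
    rw [e3]
    ring
  have hSg : 30 * S + 5 * (p * harmonicSum n 5) ∈ padicMultiples p 2 := by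
    convert sub_mem hSt (mul_mem_left (ofNat_mem 5) (self_mul_mem ht)) using 1
    ring
  have h3 : ¬ p ∣ 15 := by
    rw [show 15 = 3 * 5 by norm_num, hp.out.dvd_mul]
    exact not_or.2 ⟨Nat.not_dvd_of_pos_of_lt (by omega) (by omega),
      Nat.not_dvd_of_pos_of_lt (by omega) (by omega)⟩
  have hSH : 5 * harmonicSum (p - 1) 4 - 4 * S ∈ padicMultiples p 2 := by
    refine of_natCast_mul_mem h3 ?_
    convert sub_mem (mul_mem_left (ofNat_mem 5) hg) (mul_mem_left (ofNat_mem 2) hSg) using 1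
    push_cast
    ring
  convert add_mem hSH (mul_mem_left (ofNat_mem 4) hSB) using 1
  ring

end faulhaber

/-! ### Expansion of the sine product in powers of `p` -/

theorem one_sub_sq_div_sq (p i : ℕ) :
    1 - (p : ℚ) ^ 2 / ((i : ℚ) + 1) ^ 2 =
      -((p - (i + 1 : ℕ)) * (p + (i + 1) : ℕ)) / ((i + 1 : ℕ) : ℚ) ^ 2 := by
  have h2 : (i : ℚ) + 1 ≠ 0 := by positivity
  push_cast
  field_simp
  ring

theorem sineProduct_ne_zero {p i : ℕ} (hi : i ≤ p - 1) : sineProduct p i ≠ 0 := by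
  refine prod_ne_zero_iff.2 fun j hj => ?_
  rw [mem_range] at hj
  have h1 : (p : ℚ) - (j + 1 : ℕ) ≠ 0 := by
    rw [sub_ne_zero]
    exact_mod_cast (by omega : p ≠ j + 1)
  have h2 : ((j + 1 : ℕ) : ℚ) ≠ 0 := by positivity
  have h3 : ((p + (j + 1) : ℕ) : ℚ) ≠ 0 := by positivity
  rw [one_sub_sq_div_sq]
  exact div_ne_zero (neg_ne_zero.2 (mul_ne_zero h1 h3)) (pow_ne_zero 2 h2)

section expansion

variable {p : ℕ} [hp : Fact p.Prime]

theorem harmonicSum_sq_sub_div_two_mem {i : ℕ} (hi : i ≤ p - 1) :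
    (harmonicSum i 2 ^ 2 - harmonicSum i 4) / 2 ∈ padicMultiples p 0 := by
  rw [← doubleHarmonicSum_self i 2]
  refine sum_mem fun k hk => ?_
  have hk' : k ∈ Icc 1 (p - 1) := Icc_subset_Icc le_rfl hi hk
  rw [div_eq_mul_one_div]
  exact mul_mem (harmonicSum_sub_one_mem hk' 2) (one_div_pow_mem hk' 2)

theorem sineProduct_expansion_mem {i : ℕ} (hi : i ≤ p - 1) :
    sineProduct p i - (1 - p ^ 2 * harmonicSum i 2 +
      p ^ 4 * ((harmonicSum i 2 ^ 2 - harmonicSum i 4) / 2)) ∈ padicMultiples p 6 := by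
  induction i with
  | zero => simp [sineProduct, harmonicSum]
  | succ i ih =>
    have hi1 : i + 1 ∈ Icc 1 (p - 1) := mem_Icc.2 ⟨by omega, hi⟩
    have hx := one_div_mem hi1
    have he := harmonicSum_sq_sub_div_two_mem (p := p) (i := i) (by omega)
    have hf : 1 - (p : ℚ) ^ 2 * (1 / ((i + 1 : ℕ) : ℚ)) ^ 2 ∈ padicMultiples p 0 :=
      sub_mem padicMultiples.one_mem (mul_mem (pow_mem (natCast_mem p) 2) (pow_mem hx 2))
    rw [sineProduct, prod_range_succ, ← sineProduct, harmonicSum_succ, harmonicSum_succ]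
    convert sub_mem (mul_mem_right (ih (by omega)) hf)
      (mul_mem_right (pow_self_mem 6) (mul_mem he (pow_mem hx 2))) using 1
    push_cast
    simp only [← one_div_pow, div_eq_mul_one_div ((p : ℚ) ^ 2)]
    ring

theorem inv_sineProduct_mem {i : ℕ} (hi : i ≤ p - 1) :
    (sineProduct p i)⁻¹ ∈ padicMultiples p 0 := by
  induction i with
  | zero => simpa [sineProduct] using padicMultiples.one_mem
  | succ i ih =>
    have hi1 : i + 1 ∈ Icc 1 (p - 1) := mem_Icc.2 ⟨by omega, hi⟩
    have hplus : (((p + (i + 1) : ℕ) : ℚ))⁻¹ ∈ padicMultiples p 0 :=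
      inv_natCast_mem fun h => not_dvd_of_mem_Icc hi1 ((Nat.dvd_add_right dvd_rfl).1 h)
    rw [sineProduct, prod_range_succ, ← sineProduct, mul_inv, one_sub_sq_div_sq]
    refine mul_mem_left (ih (by omega)) ?_
    rw [inv_div, div_eq_mul_inv, inv_neg, mul_inv, ← one_div ((p : ℚ) - _)]
    exact mul_mem (pow_mem (natCast_mem _) 2) (neg_mem (mul_mem (one_div_sub_mem hi1) hplus))

theorem inv_sineProduct_sub_mem {i : ℕ} (hi : i ≤ p - 1) :
    (sineProduct p i)⁻¹ - (1 + p ^ 2 * harmonicSum i 2) ∈ padicMultiples p 3 := by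
  have hw := inv_sineProduct_mem (p := p) hi
  have hQ := mono (show 3 ≤ 6 by omega) (sineProduct_expansion_mem (p := p) hi)
  have hh := harmonicSum_mem (p := p) hi 2
  have he := harmonicSum_sq_sub_div_two_mem (p := p) hi
  have hQ0 := sineProduct_ne_zero (p := p) hi
  have hp' := natCast_mem (p := p) p
  have h1 : 1 + (p : ℚ) ^ 2 * harmonicSum i 2 ∈ padicMultiples p 0 :=
    add_mem padicMultiples.one_mem (mul_mem (pow_mem hp' 2) hh)
  have key : (sineProduct p i)⁻¹ - (1 + p ^ 2 * harmonicSum i 2) =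
      (sineProduct p i)⁻¹ * (1 - sineProduct p i * (1 + p ^ 2 * harmonicSum i 2)) := by
    field_simp
  rw [key]
  refine mul_mem_left hw ?_
  convert sub_mem (mul_mem_right (pow_self_mem 3) (mul_mem_left hp' (sub_mem (pow_mem hh 2)
    (mul_mem_left he h1)))) (mul_mem_right hQ h1) using 1
  ring

end expansion

/-! ### The main congruence -/

section main

variable {p : ℕ} [hp : Fact p.Prime]

/-- `H_{p-1}(2, 1)` modulo `p ^ 3`, from the terminating Gauss sum at `n = p`. -/
theorem doubleHarmonicSum_two_one_mem (hodd : Odd p) :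
    harmonicSum (p - 1) 1 - p ^ 2 * doubleHarmonicSum (p - 1) 2 1 +
      p ^ 4 * ((∑ k ∈ Icc 1 (p - 1), harmonicSum (k - 1) 2 ^ 2 / (k : ℚ) -
        doubleHarmonicSum (p - 1) 4 1) / 2) -
      (p * harmonicSum (p - 1) 2 -
        p ^ 3 * ((harmonicSum (p - 1) 2 ^ 2 - harmonicSum (p - 1) 4) / 2)) ∈
      padicMultiples p 5 := by
  obtain ⟨n, hn⟩ : ∃ n, p = n + 1 := ⟨p - 1, by have := hp.out.pos; omega⟩
  have hn' : p - 1 = n := by omega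
  have hp0 : (p : ℚ) ≠ 0 := by exact_mod_cast hp.out.ne_zero
  have hpn : (p : ℚ) = n + 1 := by exact_mod_cast hn
  have hne : Even n := by
    rw [hn, Nat.odd_add_one, Nat.not_odd_iff_even] at hodd
    exact hodd
  have hsum := sum_sineProduct_div n
  have hshift := sum_Icc_one_eq_sum_range (fun k => 1 / (k : ℚ) * sineProduct p (k - 1)) n
  simp only [Nat.add_sub_cancel, Nat.cast_add, Nat.cast_one] at hshift
  rw [sum_range_succ, ← hn, hne.neg_one_pow, ← hshift, ← hpn, ← hn'] at hsum
  have hterm : ∑ k ∈ Icc 1 (p - 1), 1 / (k : ℚ) * (sineProduct p (k - 1) -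
      (1 - p ^ 2 * harmonicSum (k - 1) 2 +
        p ^ 4 * ((harmonicSum (k - 1) 2 ^ 2 - harmonicSum (k - 1) 4) / 2))) ∈
      padicMultiples p 5 :=
    sum_mem fun k hk => mul_mem_left (one_div_mem hk) (mono (by omega)
      (sineProduct_expansion_mem (by have := mem_Icc.1 hk; omega)))
  have hlast := sineProduct_expansion_mem (p := p) le_rfl
  have hexp : ∑ k ∈ Icc 1 (p - 1), 1 / (k : ℚ) * (sineProduct p (k - 1) -
      (1 - p ^ 2 * harmonicSum (k - 1) 2 +
        p ^ 4 * ((harmonicSum (k - 1) 2 ^ 2 - harmonicSum (k - 1) 4) / 2))) =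
      ∑ k ∈ Icc 1 (p - 1), 1 / (k : ℚ) * sineProduct p (k - 1) -
      (harmonicSum (p - 1) 1 - p ^ 2 * doubleHarmonicSum (p - 1) 2 1 +
      p ^ 4 * ((∑ k ∈ Icc 1 (p - 1), harmonicSum (k - 1) 2 ^ 2 / (k : ℚ) -
        doubleHarmonicSum (p - 1) 4 1) / 2)) := by
    rw [harmonicSum, doubleHarmonicSum, doubleHarmonicSum]
    simp only [← sum_sub_distrib, sum_div, mul_sum, ← sum_add_distrib]
    refine sum_congr rfl fun k _ => ?_
    ring
  rw [hexp] at hterm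
  refine of_pow_mul_mem (m := 1) ?_
  convert neg_mem (add_mem (pow_mul_mem 1 hterm) hlast) using 1
  rw [eq_sub_of_add_eq hsum]
  field_simp
  ring

theorem sum_inv_sineProduct_mem :
    ∑ k ∈ Icc 1 (p - 1), harmonicSum (k - 1) 2 * (1 / ((p : ℚ) - k)) *
        (sineProduct p (k - 1))⁻¹ +
      (doubleHarmonicSum (p - 1) 2 1 + p * doubleHarmonicSum (p - 1) 2 2 +
        p ^ 2 * doubleHarmonicSum (p - 1) 2 3 +
        p ^ 2 * ∑ k ∈ Icc 1 (p - 1), harmonicSum (k - 1) 2 ^ 2 / (k : ℚ)) ∈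
      padicMultiples p 3 := by
  simp only [doubleHarmonicSum, mul_sum, ← sum_add_distrib]
  refine sum_mem fun k hk => ?_
  have hh := harmonicSum_sub_one_mem hk 2
  have hx := one_div_mem hk
  have hy := one_div_sub_mem hk
  have hw := inv_sineProduct_sub_mem (p := p) (i := k - 1) (by have := mem_Icc.1 hk; omega)
  have h := one_div_sub_eq hk
  simp only [div_eq_mul_one_div (harmonicSum (k - 1) 2),
    div_eq_mul_one_div (harmonicSum (k - 1) 2 ^ 2), ← one_div_pow]
  generalize (sineProduct p (k - 1))⁻¹ = w at *
  generalize 1 / (k : ℚ) = x at *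
  generalize 1 / ((p : ℚ) - k) = y at *
  generalize harmonicSum (k - 1) 2 = u at *
  convert add_mem (mul_mem_left (mul_mem hh hy) hw) (mul_mem_right (pow_self_mem 3)
    (add_mem (mul_mem hh (mul_mem (pow_mem hx 3) hy))
      (mul_mem (pow_mem hh 2) (mul_mem hx hy)))) using 1
  linear_combination (u * (1 + p * x + p ^ 2 * x ^ 2) + p ^ 2 * u ^ 2) * h

/-- The finite form of Leshchiner's series at `n = p - 1`, multiplied by `p`. -/
theorem self_mul_sum_inv_choose (hodd : Odd p) :
    p * (4 * ∑ k ∈ Icc 1 (p - 1), 1 / ((k : ℚ) ^ 4 * (Nat.choose (2 * k) k : ℚ)) -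
      3 * ∑ k ∈ Icc 1 (p - 1),
        harmonicSum (k - 1) 2 / ((k : ℚ) ^ 2 * (Nat.choose (2 * k) k : ℚ))) =
    p * (2 * ∑ i ∈ range (p - 1), (-1) ^ i / ((i : ℚ) + 1) ^ 4) -
      ∑ k ∈ Icc 1 (p - 1), harmonicSum (k - 1) 2 * (1 / ((p : ℚ) - k)) *
        (sineProduct p (k - 1))⁻¹ := by
  have h := sum_inv_choose_eq (p - 1)
  have hX : 4 * ∑ k ∈ Icc 1 (p - 1), 1 / ((k : ℚ) ^ 4 * (Nat.choose (2 * k) k : ℚ)) -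
      3 * ∑ k ∈ Icc 1 (p - 1),
        harmonicSum (k - 1) 2 / ((k : ℚ) ^ 2 * (Nat.choose (2 * k) k : ℚ)) =
      ∑ i ∈ range (p - 1), (4 / (((i : ℚ) + 1) ^ 4 * (2 * (i + 1)).choose (i + 1)) -
        3 * (harmonicSum i 2 / (((i : ℚ) + 1) ^ 2 * (2 * (i + 1)).choose (i + 1)))) := by
    rw [sum_Icc_one_eq_sum_range, sum_Icc_one_eq_sum_range, mul_sum, mul_sum, ← sum_sub_distrib]
    refine sum_congr rfl fun i _ => ?_
    push_cast
    rw [mul_one_div]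
  rw [hX, h, mul_add, sub_eq_add_neg, sum_Icc_one_eq_sum_range, ← sum_neg_distrib]
  congr 1
  rw [mul_sum]
  refine sum_congr rfl fun i hi => ?_
  rw [mem_range] at hi
  obtain ⟨d, hd⟩ := Nat.exists_eq_add_of_le (show i + 1 ≤ p by omega)
  have hQ := sineProduct_natCast i d
  have hQ0 := sineProduct_ne_zero (p := p) (i := i) (by omega)
  obtain ⟨e, rfl⟩ := Nat.exists_eq_add_of_le' (show 1 ≤ d by omega)
  rw [← hd, Nat.factorial_succ] at hQ
  have hp0 : (p : ℚ) ≠ 0 := by exact_mod_cast hp.out.ne_zero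
  have hpc : (p : ℚ) = i + 1 + (e + 1) := by exact_mod_cast hd
  have hsgn : (-1 : ℚ) ^ (p - 1 + i + 1) = -(-1) ^ i := by
    rw [show p - 1 + i + 1 = p + i by omega, pow_add, hodd.neg_one_pow]
    ring
  have hsq : (-1 : ℚ) ^ i * (-1) ^ i = 1 := by rw [← mul_pow]; simp
  rw [hsgn, show p - 1 - 1 - i = e by omega,
    show p - 1 + i + 1 = 2 * i + 1 + (e + 1) by omega, Nat.add_sub_cancel]
  have hy : (p : ℚ) - ((i + 1 : ℕ) : ℚ) = e + 1 := by
    rw [hpc]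
    push_cast
    ring
  rw [hy]
  have hF : ((2 * i + 1 + (e + 1)).factorial : ℚ) ≠ 0 := by positivity
  have he : (e : ℚ) + 1 ≠ 0 := by positivity
  push_cast at hQ
  field_simp
  linear_combination -(-1 : ℚ) ^ i * harmonicSum i 2 * hQ -
    (2 * i + 1 + (e + 1)).factorial * harmonicSum i 2 * hsq

theorem ratCongr_of_seven_le (h7 : 7 ≤ p) :
    RatCongr p 2
      (4 * ∑ k ∈ Icc 1 (p - 1), 1 / ((k : ℚ) ^ 4 * (Nat.choose (2 * k) k : ℚ)) -
        3 * ∑ k ∈ Icc 1 (p - 1),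
          harmonicSum (k - 1) 2 / ((k : ℚ) ^ 2 * (Nat.choose (2 * k) k : ℚ)))
      (3 / (p : ℚ) ^ 3 * harmonicSum (p - 1) 1 - 6 / 5 * (p : ℚ) * bernoulli (p - 5)) := by
  rw [ratCongr_iff]
  have hodd : Odd p := hp.out.odd_of_ne_two (by omega)
  obtain ⟨n, hpn⟩ := id hodd
  have hp0 : (p : ℚ) ≠ 0 := by exact_mod_cast hp.out.ne_zero
  have hX := self_mul_sum_inv_choose hodd
  have hA := sum_alternating_add_harmonicSum_mem hpn
  have hY := sum_inv_sineProduct_mem (p := p)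
  have h21 := doubleHarmonicSum_two_one_mem hodd
  have h1 := two_mul_harmonicSum_one_mem (p := p)
  have h3 := two_mul_harmonicSum_three_mem h7
  have hD := sum_harmonicSum_sq_div_mem h7
  have h41 := doubleHarmonicSum_four_one_mem h7
  have h23 := doubleHarmonicSum_two_three_mem h7
  have h4 := five_mul_harmonicSum_four_mem h7
  have h2 := harmonicSum_mem_one (p := p) (a := 2) (by omega) (by omega)
  have h5 := harmonicSum_mem_one (p := p) (a := 5) (by omega) (by omega)
  have h22 := doubleHarmonicSum_self (p - 1) 2
  rw [show 2 * 2 = 4 by rfl] at h22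
  rw [h22] at hY
  have h80 : ¬ p ∣ 80 := by
    rw [show 80 = 2 ^ 4 * 5 by norm_num, hp.out.dvd_mul]
    exact not_or.2 ⟨fun h => Nat.not_dvd_of_pos_of_lt (by omega) (by omega)
      (hp.out.dvd_of_dvd_pow h), Nat.not_dvd_of_pos_of_lt (by omega) (by omega)⟩
  -- `80` clears the denominators and `p ^ 3` the powers of `p` in the claim
  refine of_natCast_mul_mem h80 (of_pow_mul_mem (m := 3) ?_)
  have hsum := sub_mem (add_mem
    (mul_mem_left (ofNat_mem 80) (add_mem (add_mem (sub_mem (sub_mem (sub_mem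
      (pow_mul_mem 3 hA) (pow_mul_mem 2 hY)) h21) h1) (pow_mul_mem 4 h5))
      (pow_mul_mem 3 (mul_mem h2 h2))))
    (mul_mem_left (ofNat_mem 40) (add_mem (sub_mem (sub_mem
      (pow_mul_mem 2 h3) (pow_mul_mem 4 h41)) (pow_mul_mem 4 h23))
      (mul_mem_left (ofNat_mem 3) (pow_mul_mem 4 hD)))))
    (mul_mem_left (ofNat_mem 54) (pow_mul_mem 3 h4))
  convert hsum using 1
  push_cast
  have hR : (p : ℚ) ^ 3 * (3 / (p : ℚ) ^ 3 * harmonicSum (p - 1) 1) =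
      3 * harmonicSum (p - 1) 1 := by
    field_simp
  linear_combination 80 * (p : ℚ) ^ 2 * hX - 80 * hR

end main

theorem theorem1 (p : ℕ) (hp : p.Prime) (hp3 : 3 < p) :
    RatCongr p 2
      (4 * ∑ k ∈ Finset.Icc 1 (p - 1), 1 / ((k : ℚ) ^ 4 * (Nat.choose (2 * k) k : ℚ)) -
        3 * ∑ k ∈ Finset.Icc 1 (p - 1),
          harmonicSum (k - 1) 2 / ((k : ℚ) ^ 2 * (Nat.choose (2 * k) k : ℚ)))
      (3 / (p : ℚ) ^ 3 * harmonicSum (p - 1) 1 - 6 / 5 * (p : ℚ) * bernoulli (p - 5)) := by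
  have : Fact p.Prime := ⟨hp⟩
  rcases Nat.lt_or_ge p 7 with h | h
  · obtain rfl : p = 5 := by
      interval_cases p
      · exact absurd hp (by decide)
      · rfl
      · exact absurd hp (by decide)
    have e : Icc 1 (5 - 1) = {1, 2, 3, 4} := by decide
    refine ⟨11387 / 36288, by norm_num, ?_⟩
    simp only [e]
    norm_num [harmonicSum, Finset.sum_Icc_succ_top, Nat.choose]
  · exact ratCongr_of_seven_le h
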